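/- Let $d\ge 2$ be an integer, $\omega=e^{2\pi i/d}$, and for $n\ge 2$ consider $n$ qudits with Hilbert space $(\mathbb C^d)^{\otimes n}$ and computational basis $|q_1\dots q_n\rangle$, $q_i\in\{0,\dots,d-1\}$. The elementary hypergraph state on $n$ qudits with hyperedge multiplicity $m$ is $$|G_n^{m}\rangle = Z_e^{m}\,|+\rangle^{\otimes n}=\frac{1}{\sqrt{d^n}}\sum_{q_1,\dots,q_n=0}^{d-1}\omega^{m\,q_1\cdots q_n}\,|q_1\dots q_n\rangle ,$$ where $|+\rangle=d^{-1/2}\sum_{q}|q\rangle$ and $Z_e|q_1\dots q_n\rangle=\omega^{q_1\cdots q_n}|q_1\dots q_n\rangle$. For a unit vector $|\psi\rangle\in(\mathbb C^d)^{\otimes n}$ the multipartite entanglement is $$E(|\psi\rangle)=\min_{A\sqcup B=\{1,\dots,n\},\;A,B\ne\emptyset}\Bigl(1-\max_{|\phi^A\rangle,|\phi^B\rangle}\bigl|(\langle\phi^A|\langle\phi^B|)|\psi\rangle\bigr|^2\Bigr),$$ the maximum being over unit vectors $|\phi^A\rangle\in(\mathbb C^d)^{\otimes A}$ and $|\phi^B\rangle\in(\mathbb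 C^d)^{\otimes B}$. Then, for every multiplicity $m_e\in\mathbb N$ with $m_e\not\equiv 0 \pmod d$ and every $n\ge 2$, $$E\bigl(|G_{n+1}^{m_e}\rangle\bigr)<E\bigl(|G_n^{m_e}\rangle\bigr),$$ that is, for fixed $d$ and $m_e$ the multipartite entanglement of elementary hypergraph states is strictly decreasing in the number of qudits. -/

import Mathlib

noncomputable section

/-- The Hilbert space `⨂_{i ∈ ι} ℂ^d` of a family of qudits indexed by `ι`, in the computational
basis `|q⟩ = ⨂ |q i⟩`, `q : ι → {0, …, d-1}`. A pure state is a vector of norm one. -/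
abbrev QuditSpace (d : ℕ) (ι : Type*) : Type _ := EuclideanSpace ℂ (ι → Fin d)

/-- The primitive root of unity `ω = exp (2 π i / d)`. -/
def rootOmega (d : ℕ) : ℂ := Complex.exp (2 * Real.pi * Complex.I / d)

/-- The one-qudit state `|+⟩ = d^{-1/2} ∑_q |q⟩`. -/
def plusLocal (d : ℕ) : EuclideanSpace ℂ (Fin d) :=
  WithLp.toLp 2 fun _ => (((Real.sqrt d)⁻¹ : ℝ) : ℂ)

/-- The state `|+⟩^V = ⨂_{i ∈ V} |+⟩_i`. -/
def plusState (d : ℕ) (V : Type*) [Fintype V] : QuditSpace d V :=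
  WithLp.toLp 2 fun q => ∏ i, plusLocal d (q i)

/-- The controlled phase gate `Z_e = ∑_q ω^{∏_{i ∈ e} q_i} |q⟩⟨q|` on the qudits of `e ⊆ V`. -/
def controlledPhase (d : ℕ) {V : Type*} [Fintype V] [DecidableEq V] (e : Finset V) :
    QuditSpace d V →ₗ[ℂ] QuditSpace d V :=
  Matrix.toEuclideanLin
    (Matrix.diagonal fun q : V → Fin d => rootOmega d ^ (∏ i ∈ e, (q i : ℕ)))

/-- The elementary hypergraph state `|G_n^m⟩ = Z_e^m |+⟩^V`, where `V` has `n` vertices and `e = V`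
is the single hyperedge, of multiplicity `m`. -/
def elementaryState (d n m : ℕ) : QuditSpace d (Fin n) :=
  (controlledPhase d (Finset.univ : Finset (Fin n)) ^ m) (plusState d (Fin n))

section Entanglement

variable {d : ℕ} {V : Type*} [Fintype V] [DecidableEq V]

/-- The vector `|φ^A⟩|φ^B⟩`, where `B` is the complement of `A`. -/
def tensorAcross (A : Finset V) (φA : QuditSpace d {i // i ∈ A})
    (φB : QuditSpace d {i // i ∉ A}) : QuditSpace d V :=
  WithLp.toLp 2 fun q => φA (fun i => q i) * φB (fun i => q i)

/-- The squared overlaps of `ψ` with the pure states separable with respect to `A`, `Aᶜ`. -/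
def overlapSet (A : Finset V) (ψ : QuditSpace d V) : Set ℝ :=
  {r | ∃ (φA : QuditSpace d {i // i ∈ A}) (φB : QuditSpace d {i // i ∉ A}),
    ‖φA‖ = 1 ∧ ‖φB‖ = 1 ∧ r = ‖inner ℂ (tensorAcross A φA φB) ψ‖ ^ 2}

/-- The maximum squared overlap `α^{AB}` (see `isGreatest_maxOverlap`: it is a maximum). -/
def maxOverlap (A : Finset V) (ψ : QuditSpace d V) : ℝ := sSup (overlapSet A ψ)

/-- The bipartite entanglement `E^{AB} = 1 - α^{AB}`. -/
def bipartiteEntanglement (A : Finset V) (ψ : QuditSpace d V) : ℝ := 1 - maxOverlap A ψ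

/-- The multipartite entanglement: the minimum of `E^{AB}` over all bipartitions of `V` into two
non-empty parts `A` and `B = Aᶜ` (a finite family, non-empty when `V` has at least two elements). -/
def multipartiteEntanglement (ψ : QuditSpace d V) : ℝ :=
  ⨅ A : {A : Finset V // A.Nonempty ∧ Aᶜ.Nonempty}, bipartiteEntanglement A.1 ψ

theorem isGreatest_maxOverlap (hd : 0 < d) (A : Finset V) (ψ : QuditSpace d V) :
    IsGreatest (overlapSet A ψ) (maxOverlap A ψ) := by
  have himg : overlapSet A ψ =
      (fun p : QuditSpace d {i // i ∈ A} × QuditSpace d {i // i ∉ A} =>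
        ‖inner ℂ (tensorAcross A p.1 p.2) ψ‖ ^ 2) ''
        (Metric.sphere 0 1 ×ˢ Metric.sphere 0 1) := by
    ext r
    constructor
    · rintro ⟨φA, φB, hA, hB, rfl⟩
      exact ⟨(φA, φB), ⟨by simpa using hA, by simpa using hB⟩, rfl⟩
    · rintro ⟨⟨φA, φB⟩, ⟨hA, hB⟩, rfl⟩
      exact ⟨φA, φB, by simpa using hA, by simpa using hB, rfl⟩
  have hcont : Continuous fun p : QuditSpace d {i // i ∈ A} × QuditSpace d {i // i ∉ A} =>
      ‖inner ℂ (tensorAcross A p.1 p.2) ψ‖ ^ 2 := by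
    have h : Continuous fun p : QuditSpace d {i // i ∈ A} × QuditSpace d {i // i ∉ A} =>
        tensorAcross A p.1 p.2 := by
      unfold tensorAcross
      fun_prop
    exact (h.inner continuous_const).norm.pow 2
  have hcpt : IsCompact (overlapSet A ψ) := by
    rw [himg]
    exact ((isCompact_sphere _ _).prod (isCompact_sphere _ _)).image hcont
  have hne : (overlapSet A ψ).Nonempty :=
    ⟨_, EuclideanSpace.single (fun _ => ⟨0, hd⟩) 1, EuclideanSpace.single (fun _ => ⟨0, hd⟩) 1,
      by simp, by simp, rfl⟩
  exact hcpt.isGreatest_sSup hne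

end Entanglement

end

/-! Fix a cut with `|A| = a + 1`. Optimizing over `φA` leaves the quadratic form `d^{-|B|} ∑ conj
(φB y) φB y' K_a(∏y - ∏y')`, where `K_a(t)` is the mean of `ω^{m t x₁⋯x_{a+1}}`. Averaging out one
variable turns the phase into a divisibility indicator, so `K_a` is nonnegative and the supremum may
be taken over real `f ≥ 0`.

Adding a qudit to `A` keeps the prefactor and replaces `K_a` by `K_{a+1}`, which is pointwise
larger, strictly so unless `d ∣ m t`. Hence the maximal overlap strictly increases
(`exists_quadratic_lt` handles a maximizer that sees no strict entry). Enlarging one side of an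
optimal cut of `n` qudits gives a strictly less entangled cut of `n + 1`. -/

/-! ### The divisibility kernel and its monotonicity -/

/-- The average over `z ∈ {0, …, d-1}^a` of the indicator of `d ∣ m t z₁ ⋯ z_a`. -/
noncomputable def phaseKernel (d m : ℕ) : ℕ → ℤ → ℝ
  | 0, t => if (d : ℤ) ∣ m * t then 1 else 0
  | a + 1, t => (∑ z : Fin d, phaseKernel d m a (t * (z : ℕ))) / d

theorem phaseKernel_nonneg (d m a : ℕ) (t : ℤ) : 0 ≤ phaseKernel d m a t := by
  induction a generalizing t with
  | zero => unfold phaseKernel; split_ifs <;> norm_num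
  | succ a ih =>
    rw [phaseKernel]
    exact div_nonneg (Finset.sum_nonneg fun z _ => ih _) (Nat.cast_nonneg d)

theorem phaseKernel_of_dvd {d m : ℕ} (hd : 2 ≤ d) (a : ℕ) {t : ℤ} (ht : (d : ℤ) ∣ m * t) :
    phaseKernel d m a t = 1 := by
  induction a generalizing t with
  | zero => simp [phaseKernel, ht]
  | succ a ih =>
    have h : ∀ z : Fin d, phaseKernel d m a (t * (z : ℕ)) = 1 := fun z =>
      ih (by rw [← mul_assoc]; exact ht.mul_right _)
    have hd0 : (d : ℝ) ≠ 0 := by positivity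
    simp [phaseKernel, h, hd0]

theorem phaseKernel_le_succ {d m : ℕ} (hd : 2 ≤ d) (a : ℕ) (t : ℤ) :
    phaseKernel d m a t ≤ phaseKernel d m (a + 1) t := by
  induction a generalizing t with
  | zero =>
    by_cases ht : (d : ℤ) ∣ m * t
    · rw [phaseKernel_of_dvd hd _ ht, phaseKernel_of_dvd hd _ ht]
    · rw [phaseKernel, if_neg ht]
      exact phaseKernel_nonneg _ _ _ _
  | succ a ih =>
    rw [phaseKernel, phaseKernel]
    gcongr with z
    exact ih _

/-- The term `z = 0` alone contributes `1 / d`. -/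
theorem inv_le_phaseKernel_succ {d : ℕ} (m : ℕ) (hd : 2 ≤ d) (a : ℕ) (t : ℤ) :
    (d : ℝ)⁻¹ ≤ phaseKernel d m (a + 1) t := by
  have h := Finset.single_le_sum (f := fun z : Fin d => phaseKernel d m a (t * (z : ℕ)))
    (fun z _ => phaseKernel_nonneg _ _ _ _) (Finset.mem_univ (⟨0, by omega⟩ : Fin d))
  rw [phaseKernel_of_dvd hd a (by simp)] at h
  rw [phaseKernel, ← one_div]
  gcongr

/-- The term `z = 1` leaves `t` unchanged, so strictness propagates by induction from the case where
the kernel is `0`. -/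
theorem phaseKernel_lt_succ {d m : ℕ} (hd : 2 ≤ d) (a : ℕ) {t : ℤ} (ht : ¬ (d : ℤ) ∣ m * t) :
    phaseKernel d m a t < phaseKernel d m (a + 1) t := by
  induction a generalizing t with
  | zero =>
    have h := inv_le_phaseKernel_succ m hd 0 t
    have : (0 : ℝ) < (d : ℝ)⁻¹ := by positivity
    rw [phaseKernel, if_neg ht]
    linarith
  | succ a ih =>
    rw [phaseKernel, phaseKernel]
    refine div_lt_div_of_pos_right ?_ (by positivity)
    refine Finset.sum_lt_sum (fun z _ => phaseKernel_le_succ hd a _)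
      ⟨⟨1, by omega⟩, Finset.mem_univ _, ?_⟩
    exact ih (by simpa using ht)

/-! ### Character sums -/

theorem isPrimitiveRoot_rootOmega {d : ℕ} (hd : d ≠ 0) : IsPrimitiveRoot (rootOmega d) d :=
  Complex.isPrimitiveRoot_exp d hd

theorem norm_rootOmega {d : ℕ} (hd : d ≠ 0) : ‖rootOmega d‖ = 1 :=
  (isPrimitiveRoot_rootOmega hd).norm'_eq_one hd

theorem sum_rootOmega_zpow_mul {d : ℕ} (hd : d ≠ 0) (s : ℤ) :
    ∑ z : Fin d, rootOmega d ^ (s * (z : ℕ)) = if (d : ℤ) ∣ s then (d : ℂ) else 0 := by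
  have hω := isPrimitiveRoot_rootOmega hd
  have h : ∑ z : Fin d, rootOmega d ^ (s * (z : ℕ)) =
      ∑ z ∈ Finset.range d, (rootOmega d ^ s) ^ z := by
    rw [Finset.sum_range]
    exact Finset.sum_congr rfl fun z _ => by rw [zpow_mul, zpow_natCast]
  rw [h]
  split_ifs with hs
  · simp [(hω.zpow_eq_one_iff_dvd s).2 hs]
  · have hne : rootOmega d ^ s ≠ 1 := fun h => hs ((hω.zpow_eq_one_iff_dvd s).1 h)
    rw [geom_sum_eq hne, ← zpow_natCast, ← zpow_mul, mul_comm, zpow_mul, zpow_natCast,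
      hω.pow_eq_one]
    simp

theorem sum_rootOmega_zpow_prod_fin {d : ℕ} (hd : d ≠ 0) (m a : ℕ) (t : ℤ) :
    ∑ x : Fin (a + 1) → Fin d, rootOmega d ^ (m * t * ((∏ i, (x i : ℕ) : ℕ) : ℤ)) =
      (d : ℂ) ^ (a + 1) * phaseKernel d m a t := by
  induction a generalizing t with
  | zero =>
    rw [← (Equiv.funUnique (Fin 1) (Fin d)).symm.sum_comp]
    simp only [phaseKernel, zero_add, pow_one]
    have := sum_rootOmega_zpow_mul hd (m * t)
    simp [Equiv.funUnique] at this ⊢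
    rw [this]
    split_ifs <;> simp
  | succ a ih =>
    rw [← (Fin.consEquiv fun _ : Fin (a + 2) => Fin d).sum_comp, Fintype.sum_prod_type]
    have h : ∀ z : Fin d, ∑ x : Fin (a + 1) → Fin d, rootOmega d ^ (m * t *
        ((∏ i, (Fin.consEquiv (fun _ : Fin (a + 2) => Fin d) (z, x) i : ℕ) : ℕ) : ℤ)) =
        (d : ℂ) ^ (a + 1) * phaseKernel d m a (t * (z : ℕ)) := fun z => by
      rw [← ih]
      refine Finset.sum_congr rfl fun x _ => ?_
      congr 1
      simp [Fin.prod_univ_succ, Fin.consEquiv]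
      ring
    have hd0 : (d : ℂ) ≠ 0 := by exact_mod_cast hd
    rw [Finset.sum_congr rfl fun z _ => h z, ← Finset.mul_sum, phaseKernel]
    push_cast
    field_simp
    ring

theorem sum_rootOmega_zpow_prod {d : ℕ} (hd : d ≠ 0) (m a : ℕ) (t : ℤ) {ι : Type*} [Fintype ι]
    [DecidableEq ι] (hι : Fintype.card ι = a + 1) :
    ∑ x : ι → Fin d, rootOmega d ^ (m * t * ((∏ i, (x i : ℕ) : ℕ) : ℤ)) =
      (d : ℂ) ^ (a + 1) * phaseKernel d m a t := by
  rw [← sum_rootOmega_zpow_prod_fin hd]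
  let e := Fintype.equivFinOfCardEq hι
  rw [← (e.arrowCongr (Equiv.refl (Fin d))).sum_comp]
  refine Finset.sum_congr rfl fun x _ => ?_
  rw [← e.prod_comp]
  simp

theorem elementaryState_apply (d n m : ℕ) (q : Fin n → Fin d) :
    elementaryState d n m q =
      (((Real.sqrt d)⁻¹ : ℝ) : ℂ) ^ n * rootOmega d ^ (m * ∏ i, (q i : ℕ)) := by
  have h : ∀ ψ : QuditSpace d (Fin n), (controlledPhase d (Finset.univ : Finset (Fin n)) ^ m) ψ q =
      rootOmega d ^ (m * ∏ i, (q i : ℕ)) * ψ q := by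
    induction m with
    | zero => simp
    | succ m ih =>
      intro ψ
      rw [pow_succ, Module.End.mul_apply, ih, controlledPhase, Matrix.toLpLin_apply]
      simp [Matrix.mulVec_diagonal, add_mul, pow_add, mul_assoc]
  rw [elementaryState, h, plusState, mul_comm]
  simp [plusLocal]

/-! ### Eliminating `φA` from the overlap -/

/-- The unnormalized state of the qudits of `A` left after projecting the other qudits of `ψ`
onto `φB`. -/
noncomputable def residualState {d : ℕ} {V : Type*} [Fintype V] [DecidableEq V] (A : Finset V)
    (φB : QuditSpace d {i // i ∉ A}) (ψ : QuditSpace d V) : QuditSpace d {i // i ∈ A} :=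
  WithLp.toLp 2 fun x => ∑ y, star (φB y) *
    ψ ((Equiv.piEquivPiSubtypeProd (fun i => i ∈ A) fun _ => Fin d).symm (x, y))

section Residual

variable {d : ℕ} {V : Type*} [Fintype V] [DecidableEq V]

theorem inner_tensorAcross (A : Finset V) (φA : QuditSpace d {i // i ∈ A})
    (φB : QuditSpace d {i // i ∉ A}) (ψ : QuditSpace d V) :
    inner ℂ (tensorAcross A φA φB) ψ = inner ℂ φA (residualState A φB ψ) := by
  simp only [PiLp.inner_apply, RCLike.inner_apply', tensorAcross, residualState]
  rw [← (Equiv.piEquivPiSubtypeProd (fun i => i ∈ A) fun _ => Fin d).symm.sum_comp,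
    Fintype.sum_prod_type]
  refine Finset.sum_congr rfl fun x _ => ?_
  rw [Finset.mul_sum]
  refine Finset.sum_congr rfl fun y _ => ?_
  have hx : (fun i : {i // i ∈ A} =>
      (Equiv.piEquivPiSubtypeProd (fun i => i ∈ A) fun _ => Fin d).symm (x, y) i) = x := by
    ext i; simp [Equiv.piEquivPiSubtypeProd]
  have hy : (fun i : {i // i ∉ A} =>
      (Equiv.piEquivPiSubtypeProd (fun i => i ∈ A) fun _ => Fin d).symm (x, y) i) = y := by
    ext i; simp [Equiv.piEquivPiSubtypeProd, i.2]
  rw [hx, hy]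
  simp only [map_mul, starRingEnd_apply]
  ring

theorem exists_maxOverlap_le_residualState (hd : 0 < d) (A : Finset V) (ψ : QuditSpace d V) :
    ∃ φB : QuditSpace d {i // i ∉ A}, ‖φB‖ = 1 ∧
      maxOverlap A ψ ≤ ‖residualState A φB ψ‖ ^ 2 := by
  obtain ⟨φA, φB, hA, hB, h⟩ := (isGreatest_maxOverlap hd A ψ).1
  refine ⟨φB, hB, ?_⟩
  rw [h, inner_tensorAcross]
  gcongr
  simpa [hA] using norm_inner_le_norm (𝕜 := ℂ) φA (residualState A φB ψ)

theorem residualState_le_maxOverlap (hd : 0 < d) (A : Finset V) (ψ : QuditSpace d V)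
    {φB : QuditSpace d {i // i ∉ A}} (hB : ‖φB‖ = 1) :
    ‖residualState A φB ψ‖ ^ 2 ≤ maxOverlap A ψ := by
  refine (isGreatest_maxOverlap hd A ψ).2 ?_
  set v := residualState A φB ψ with hv
  by_cases h0 : v = 0
  · refine ⟨EuclideanSpace.single (fun _ => ⟨0, hd⟩) 1, φB, by simp, hB, ?_⟩
    rw [inner_tensorAcross, ← hv, h0]
    simp
  · have hn : ‖v‖ ≠ 0 := norm_ne_zero_iff.2 h0
    -- Equality in Cauchy–Schwarz: the best `φA` is the normalized residual.
    refine ⟨((‖v‖⁻¹ : ℝ) : ℂ) • v, φB, ?_, hB, ?_⟩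
    · rw [norm_smul]
      simp [hn]
    · rw [inner_tensorAcross, ← hv, inner_smul_left, inner_self_eq_norm_sq_to_K]
      simp
      field_simp

end Residual

/-! ### Overlaps as values of a real quadratic form -/

/-- The quadratic form of the Gram matrix of an elementary hypergraph state: `a + 1` qudits are
traced out, those of `ι` are kept. -/
noncomputable def phaseForm (d m a : ℕ) {ι : Type*} [Fintype ι] [DecidableEq ι]
    (f : (ι → Fin d) → ℝ) : ℝ :=
  ((d : ℝ) ^ Fintype.card ι)⁻¹ *
    ∑ y, ∑ y', f y * f y' * phaseKernel d m a ((∏ i, (y i : ℕ) : ℕ) - (∏ i, (y' i : ℕ) : ℕ))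

theorem norm_sq_residualState {d n : ℕ} (hd : d ≠ 0) (m a : ℕ) (A : Finset (Fin n))
    (hA : A.card = a + 1) (φB : QuditSpace d {i // i ∉ A}) :
    ((‖residualState A φB (elementaryState d n m)‖ ^ 2 : ℝ) : ℂ) =
      ((d : ℂ) ^ Fintype.card {i // i ∉ A})⁻¹ * ∑ y, ∑ y', star (φB y) * φB y' *
        phaseKernel d m a ((∏ i, (y i : ℕ) : ℕ) - (∏ i, (y' i : ℕ) : ℕ)) := by
  have hcard : Fintype.card {i // i ∈ A} = a + 1 := by simpa using hA
  have hn : n = a + 1 + Fintype.card {i // i ∉ A} := by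
    have := Fintype.card_subtype_compl (fun i => i ∈ A)
    have h2 := Fintype.card_subtype_le (fun i => i ∈ A)
    simp only [Fintype.card_fin] at this h2
    omega
  have hd0 : (d : ℂ) ≠ 0 := by exact_mod_cast hd
  have hω0 : rootOmega d ≠ 0 := (isPrimitiveRoot_rootOmega hd).ne_zero hd
  have hstar : star (rootOmega d) = (rootOmega d)⁻¹ := by
    rw [Complex.inv_eq_conj (norm_rootOmega hd)]; rfl
  set c : ℂ := (((Real.sqrt d)⁻¹ : ℝ) : ℂ) with hc
  have hcc : star (c ^ n) * c ^ n = ((d : ℂ) ^ n)⁻¹ := by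
    have : star c * c = (d : ℂ)⁻¹ := by
      have h2 : ((Real.sqrt d)⁻¹ : ℝ) * (Real.sqrt d)⁻¹ = (d : ℝ)⁻¹ := by
        rw [← mul_inv, Real.mul_self_sqrt (Nat.cast_nonneg d)]
      rw [hc, ← starRingEnd_apply, Complex.conj_ofReal, ← Complex.ofReal_mul, h2]
      simp
    rw [star_pow, ← mul_pow, this, inv_pow]
  have hval : ∀ x, residualState A φB (elementaryState d n m) x =
      ∑ y, star (φB y) * (c ^ n * rootOmega d ^ (m * ((∏ i, (x i : ℕ)) * ∏ i, (y i : ℕ)))) := by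
    intro x
    simp only [residualState]
    refine Finset.sum_congr rfl fun y _ => ?_
    rw [elementaryState_apply, ← Fintype.prod_subtype_mul_prod_subtype (fun i => i ∈ A)]
    congr 5
    · refine Finset.prod_congr (by ext; simp) fun i _ => ?_
      simp [Equiv.piEquivPiSubtypeProd, i.2]
    · refine Finset.prod_congr rfl fun i _ => ?_
      simp [Equiv.piEquivPiSubtypeProd, i.2]
  have hnorm : ((‖residualState A φB (elementaryState d n m)‖ ^ 2 : ℝ) : ℂ) =
      ∑ x, residualState A φB (elementaryState d n m) x *
        star (residualState A φB (elementaryState d n m) x) := by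
    rw [EuclideanSpace.norm_sq_eq]
    push_cast
    refine Finset.sum_congr rfl fun x _ => ?_
    exact (Complex.mul_conj' _).symm
  have hterm : ∀ (x : {i // i ∈ A} → Fin d) (y y' : {i // i ∉ A} → Fin d),
      star (φB y) * (c ^ n * rootOmega d ^ (m * ((∏ i, (x i : ℕ)) * ∏ i, (y i : ℕ)))) *
        star (star (φB y') *
          (c ^ n * rootOmega d ^ (m * ((∏ i, (x i : ℕ)) * ∏ i, (y' i : ℕ))))) =
      ((d : ℂ) ^ n)⁻¹ * (star (φB y) * φB y') * rootOmega d ^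
        ((m : ℤ) * ((∏ i, (y i : ℕ) : ℕ) - (∏ i, (y' i : ℕ) : ℕ)) *
          ((∏ i, (x i : ℕ) : ℕ) : ℤ)) := by
    intro x y y'
    generalize (∏ i, (x i : ℕ)) = X
    generalize (∏ i, (y i : ℕ)) = Y
    generalize (∏ i, (y' i : ℕ)) = Y'
    have hexp : (m : ℤ) * ((Y : ℤ) - (Y' : ℤ)) * (X : ℤ) =
        ((m * (X * Y) : ℕ) : ℤ) - ((m * (X * Y') : ℕ) : ℤ) := by
      push_cast; ring
    rw [← hcc, hexp, zpow_sub₀ hω0, zpow_natCast, zpow_natCast, star_mul', star_mul', star_star,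
      star_pow (rootOmega d), hstar, inv_pow, div_eq_mul_inv]
    ring
  rw [hnorm]
  simp only [hval, star_sum, Finset.sum_mul_sum, hterm]
  rw [Finset.sum_comm, Finset.mul_sum]
  refine Finset.sum_congr rfl fun y _ => ?_
  rw [Finset.sum_comm, Finset.mul_sum]
  refine Finset.sum_congr rfl fun y' _ => ?_
  rw [← Finset.mul_sum, sum_rootOmega_zpow_prod hd m a _ hcard]
  have hpow : (d : ℂ) ^ n = (d : ℂ) ^ (a + 1) * (d : ℂ) ^ Fintype.card {i // i ∉ A} := by
    rw [← pow_add]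
    congr 1
  rw [hpow, mul_inv]
  have : (d : ℂ) ^ (a + 1) ≠ 0 := pow_ne_zero _ hd0
  field_simp

/-- Since the kernel is nonnegative, the triangle inequality allows `φB` to be replaced by its
entrywise modulus. -/
theorem exists_maxOverlap_le_phaseForm {d n : ℕ} (hd : 0 < d) (m a : ℕ) (A : Finset (Fin n))
    (hA : A.card = a + 1) :
    ∃ f : ({i // i ∉ A} → Fin d) → ℝ, (∀ y, 0 ≤ f y) ∧ ∑ y, f y ^ 2 = 1 ∧
      maxOverlap A (elementaryState d n m) ≤ phaseForm d m a f := by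
  obtain ⟨φB, hB, h⟩ := exists_maxOverlap_le_residualState hd A (elementaryState d n m)
  refine ⟨fun y => ‖φB y‖, fun y => norm_nonneg _, ?_, h.trans ?_⟩
  · rw [← EuclideanSpace.norm_sq_eq, hB, one_pow]
  · have h1 := norm_sq_residualState hd.ne' m a A hA φB
    have h2 : ‖residualState A φB (elementaryState d n m)‖ ^ 2 =
        ‖((‖residualState A φB (elementaryState d n m)‖ ^ 2 : ℝ) : ℂ)‖ := by
      rw [Complex.norm_real, Real.norm_of_nonneg (by positivity)]
    rw [h2, h1, norm_mul, phaseForm]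
    have h3 : ‖((d : ℂ) ^ Fintype.card {i // i ∉ A})⁻¹‖ =
        ((d : ℝ) ^ Fintype.card {i // i ∉ A})⁻¹ := by simp
    rw [h3]
    refine mul_le_mul_of_nonneg_left ?_ (by positivity)
    refine (norm_sum_le _ _).trans (Finset.sum_le_sum fun y _ => ?_)
    refine (norm_sum_le _ _).trans (Finset.sum_le_sum fun y' _ => ?_)
    rw [norm_mul, norm_mul, norm_star, Complex.norm_real,
      Real.norm_of_nonneg (phaseKernel_nonneg _ _ _ _)]

theorem phaseForm_le_maxOverlap {d n : ℕ} (hd : 0 < d) (m a : ℕ) (A : Finset (Fin n))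
    (hA : A.card = a + 1) (f : ({i // i ∉ A} → Fin d) → ℝ) (hf : ∑ y, f y ^ 2 = 1) :
    phaseForm d m a f ≤ maxOverlap A (elementaryState d n m) := by
  set φB : QuditSpace d {i // i ∉ A} := WithLp.toLp 2 fun y => (f y : ℂ) with hφ
  have hB : ‖φB‖ = 1 := by
    rw [← sq_eq_sq₀ (norm_nonneg _) zero_le_one, EuclideanSpace.norm_sq_eq, one_pow, ← hf]
    simp [hφ]
  refine le_of_eq_of_le ?_ (residualState_le_maxOverlap hd A (elementaryState d n m) hB)
  have h1 := norm_sq_residualState hd.ne' m a A hA φB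
  apply Complex.ofReal_injective
  rw [h1, phaseForm]
  simp [hφ]

theorem phaseForm_reindex (d m a : ℕ) {ι κ : Type*} [Fintype ι] [Fintype κ] [DecidableEq ι]
    [DecidableEq κ] (e : ι ≃ κ) (f : (ι → Fin d) → ℝ) :
    phaseForm d m a (fun y : κ → Fin d => f (y ∘ e)) = phaseForm d m a f := by
  unfold phaseForm
  rw [Fintype.card_congr e, ← (e.arrowCongr (Equiv.refl (Fin d))).sum_comp]
  congr 1
  refine Finset.sum_congr rfl fun y _ => ?_
  rw [← (e.arrowCongr (Equiv.refl (Fin d))).sum_comp]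
  refine Finset.sum_congr rfl fun y' _ => ?_
  simp only [← e.prod_comp]
  simp [Function.comp_def]

/-! ### Strict increase of the maximum -/

/-- A quadratic form with nonnegative kernel `K` has unit-vector values strictly below the maximum
of the one with kernel `L`, if `K ≤ L`, with strict inequality between distinct classes of `r` and
`K = 1` within each class, and `L` is bounded below by a positive constant. -/
theorem exists_quadratic_lt {Y : Type*} [Fintype Y] (r : Setoid Y) {K L : Y → Y → ℝ}
    {ε : ℝ} (hε : 0 < ε) (hKL : ∀ y z, K y z ≤ L y z) (hK : ∀ y z, r y z → K y z = 1)
    (hlt : ∀ y z, ¬ r y z → K y z < L y z) (hL : ∀ y z, ε ≤ L y z) {y₀ y₁ : Y} (hr : ¬ r y₀ y₁)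
    {f : Y → ℝ} (hf0 : ∀ y, 0 ≤ f y) (hf : ∑ y, f y ^ 2 = 1) :
    ∃ g : Y → ℝ, ∑ y, g y ^ 2 = 1 ∧
      ∑ y, ∑ z, f y * f z * K y z < ∑ y, ∑ z, g y * g z * L y z := by
  classical
  -- If `f` charges two classes, `f` itself meets a strict entry; otherwise it lives on one class
  -- `C` and a new vector is needed.
  by_cases hsupp : ∃ y z, ¬ r y z ∧ 0 < f y ∧ 0 < f z
  · obtain ⟨y, z, hyz, hy, hz⟩ := hsupp
    have hle : ∀ y z, f y * f z * K y z ≤ f y * f z * L y z := fun y z =>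
      mul_le_mul_of_nonneg_left (hKL y z) (mul_nonneg (hf0 y) (hf0 z))
    refine ⟨f, hf, Finset.sum_lt_sum (fun y _ => Finset.sum_le_sum fun z _ => hle y z)
      ⟨y, Finset.mem_univ y, Finset.sum_lt_sum (fun z _ => hle y z) ⟨z, Finset.mem_univ z, ?_⟩⟩⟩
    exact mul_lt_mul_of_pos_left (hlt y z hyz) (mul_pos hy hz)
  · push Not at hsupp
    obtain ⟨u, hu⟩ : ∃ u, 0 < f u := by
      by_contra! h
      have : ∀ y, f y = 0 := fun y => le_antisymm (h y) (hf0 y)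
      simp [this] at hf
    have hout : ∀ y, ¬ r u y → f y = 0 := fun y hy => le_antisymm (hsupp u y hy hu) (hf0 y)
    set C : Finset Y := Finset.univ.filter fun y => r u y with hC
    -- On `C` the kernel is `1`, so the form is `(∑ f)²`; Cauchy–Schwarz bounds it by `|C|`.
    have hup : ∑ y, ∑ z, f y * f z * K y z ≤ (C.card : ℝ) := by
      have h1 : ∑ y, ∑ z, f y * f z * K y z = (∑ y ∈ C, f y) ^ 2 := by
        have h2 : ∑ y ∈ C, f y = ∑ y, f y :=
          Finset.sum_subset (Finset.subset_univ _) fun y _ hy => hout y (by simpa [hC] using hy)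
        rw [h2, sq, Finset.sum_mul_sum]
        refine Finset.sum_congr rfl fun y _ => Finset.sum_congr rfl fun z _ => ?_
        by_cases hy : r u y
        · by_cases hz : r u z
          · rw [hK y z (r.trans' (r.symm' hy) hz), mul_one]
          · simp [hout z hz]
        · simp [hout y hy]
      have h3 : ∑ y ∈ C, f y ^ 2 ≤ 1 := by
        rw [← hf]
        exact Finset.sum_le_sum_of_subset_of_nonneg (Finset.subset_univ _)
          fun y _ _ => sq_nonneg _
      rw [h1]
      calc (∑ y ∈ C, f y) ^ 2 ≤ C.card * ∑ y ∈ C, f y ^ 2 := sq_sum_le_card_mul_sum_sq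
        _ ≤ C.card * 1 := by gcongr
        _ = C.card := mul_one _
    have hCpos : (0 : ℝ) < C.card := by
      exact_mod_cast Finset.card_pos.2 ⟨u, by simp [hC]⟩
    have hDpos : (0 : ℝ) < Cᶜ.card := by
      refine Nat.cast_pos.2 (Finset.card_pos.2 ?_)
      by_cases h0 : r u y₀
      · exact ⟨y₁, by simpa [hC] using fun h1 => hr (r.trans' (r.symm' h0) h1)⟩
      · exact ⟨y₀, by simpa [hC] using h0⟩
    set p : ℝ := (C.card : ℝ)
    set q : ℝ := (Cᶜ.card : ℝ)
    -- Leaking weight `ε` outside `C` costs `q ε²` in squared norm, while the cross terms gain at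
    -- least `2 p q ε · ε`.
    set h : Y → ℝ := fun y => if y ∈ C then 1 else ε with hh
    have hhC : ∀ y ∈ C, h y = 1 := fun y hy => by simp [hh, hy]
    have hhD : ∀ y ∈ Cᶜ, h y = ε := fun y hy => by simp [hh, Finset.mem_compl.1 hy]
    have hN : ∑ y, h y ^ 2 = p + q * ε ^ 2 := by
      rw [← Finset.sum_add_sum_compl C, Finset.sum_congr rfl fun y hy => by rw [hhC y hy],
        Finset.sum_congr (s₁ := Cᶜ) rfl fun y hy => by rw [hhD y hy]]
      simp [p, q]
    have hcross : ∀ S T : Finset Y, ∀ s t k : ℝ, 0 ≤ s → 0 ≤ t → (∀ y ∈ S, h y = s) →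
        (∀ z ∈ T, h z = t) → (∀ y ∈ S, ∀ z ∈ T, k ≤ L y z) →
        S.card * (T.card * (s * t * k)) ≤ ∑ y ∈ S, ∑ z ∈ T, h y * h z * L y z := by
      intro S T s t k hs ht hS hT hk
      rw [← nsmul_eq_mul, ← nsmul_eq_mul]
      refine Finset.card_nsmul_le_sum _ _ _ fun y hy => ?_
      refine Finset.card_nsmul_le_sum _ _ _ fun z hz => ?_
      rw [hS y hy, hT z hz]
      exact mul_le_mul_of_nonneg_left (hk y hy z hz) (mul_nonneg hs ht)
    have hQ : p ^ 2 + 2 * (p * q * ε ^ 2) ≤ ∑ y, ∑ z, h y * h z * L y z := by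
      have hsplit : ∑ y, ∑ z, h y * h z * L y z =
          (∑ y ∈ C, ∑ z ∈ C, h y * h z * L y z + ∑ y ∈ C, ∑ z ∈ Cᶜ, h y * h z * L y z) +
          (∑ y ∈ Cᶜ, ∑ z ∈ C, h y * h z * L y z +
            ∑ y ∈ Cᶜ, ∑ z ∈ Cᶜ, h y * h z * L y z) := by
        simp only [← Finset.sum_add_distrib, Finset.sum_add_sum_compl]
      have hCC := hcross C C 1 1 1 zero_le_one zero_le_one hhC hhC fun y hy z hz => by
        rw [← hK y z (r.trans' (r.symm' (by simpa [hC] using hy)) (by simpa [hC] using hz))]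
        exact hKL y z
      have hCD := hcross C Cᶜ 1 ε ε zero_le_one hε.le hhC hhD fun y _ z _ => hL y z
      have hDC := hcross Cᶜ C ε 1 ε hε.le zero_le_one hhD hhC fun y _ z _ => hL y z
      have hDD := hcross Cᶜ Cᶜ ε ε ε hε.le hε.le hhD hhD fun y _ z _ => hL y z
      have hDD' : 0 ≤ q * (q * (ε * ε * ε)) := by positivity
      rw [hsplit]
      change p * (p * _) ≤ _ at hCC
      change p * (q * _) ≤ _ at hCD
      change q * (p * _) ≤ _ at hDC
      change q * (q * _) ≤ _ at hDD
      linarith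
    have hNpos : 0 < p + q * ε ^ 2 := by positivity
    refine ⟨fun y => h y / Real.sqrt (p + q * ε ^ 2), ?_, hup.trans_lt ?_⟩
    · simp only [div_pow, Real.sq_sqrt hNpos.le]
      rw [← Finset.sum_div, hN, div_self hNpos.ne']
    · have hscale : ∑ y, ∑ z, h y / Real.sqrt (p + q * ε ^ 2) *
          (h z / Real.sqrt (p + q * ε ^ 2)) * L y z =
          (∑ y, ∑ z, h y * h z * L y z) / (p + q * ε ^ 2) := by
        simp only [Finset.sum_div]
        refine Finset.sum_congr rfl fun y _ => Finset.sum_congr rfl fun z _ => ?_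
        rw [div_mul_div_comm, Real.mul_self_sqrt hNpos.le]
        ring
      rw [hscale, lt_div_iff₀ hNpos]
      -- This is the surplus of the lower bound `hQ` over `p * (p + q * ε ^ 2)`.
      have : 0 < p * q * ε ^ 2 := by positivity
      linarith

theorem exists_phaseForm_lt_succ {d m : ℕ} (hd : 2 ≤ d) (hm : ¬ d ∣ m) (a : ℕ) {ι : Type*}
    [Fintype ι] [DecidableEq ι] [Nonempty ι] {f : (ι → Fin d) → ℝ} (hf0 : ∀ y, 0 ≤ f y)
    (hf : ∑ y, f y ^ 2 = 1) :
    ∃ g : (ι → Fin d) → ℝ, ∑ y, g y ^ 2 = 1 ∧ phaseForm d m a f < phaseForm d m (a + 1) g := by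
  let r : Setoid (ι → Fin d) :=
    { r := fun y z => (d : ℤ) ∣ m * (((∏ i, (y i : ℕ) : ℕ) : ℤ) - (∏ i, (z i : ℕ) : ℕ))
      iseqv := ⟨fun y => by simp, fun {y z} h => by simpa [mul_sub] using (dvd_neg.2 h),
        fun {x y z} h h' => by
          have := dvd_add h h'
          rwa [← mul_add, sub_add_sub_cancel] at this⟩ }
  -- The products are `1` and `0` (`ι` is nonempty), so equivalence would mean `d ∣ m`.
  have hr : ¬ r (fun _ => ⟨1, by omega⟩) (fun _ => ⟨0, by omega⟩) := by
    change ¬ ((d : ℤ) ∣ _)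
    have hc : Fintype.card ι ≠ 0 := Fintype.card_ne_zero
    simp [hc]
    exact_mod_cast hm
  obtain ⟨g, hg, hlt⟩ := exists_quadratic_lt r
    (K := fun y z => phaseKernel d m a ((∏ i, (y i : ℕ) : ℕ) - (∏ i, (z i : ℕ) : ℕ)))
    (L := fun y z => phaseKernel d m (a + 1) ((∏ i, (y i : ℕ) : ℕ) - (∏ i, (z i : ℕ) : ℕ)))
    (ε := (d : ℝ)⁻¹) (by positivity) (fun y z => phaseKernel_le_succ hd a _)
    (fun y z h => phaseKernel_of_dvd hd a h) (fun y z h => phaseKernel_lt_succ hd a h)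
    (fun y z => inv_le_phaseKernel_succ m hd a _) hr hf0 hf
  have hd0 : (0 : ℝ) < d := by positivity
  exact ⟨g, hg, mul_lt_mul_of_pos_left hlt (inv_pos.2 (pow_pos hd0 _))⟩

/-! ### Comparing cuts of `n` and `n + 1` qudits -/

theorem maxOverlap_elementaryState_lt {d m n : ℕ} (hd : 2 ≤ d) (hm : ¬ d ∣ m)
    {A : Finset (Fin n)} (hA : A.Nonempty) (hAc : Aᶜ.Nonempty) {A' : Finset (Fin (n + 1))}
    (hA' : A'.card = A.card + 1) :
    maxOverlap A (elementaryState d n m) < maxOverlap A' (elementaryState d (n + 1) m) := by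
  obtain ⟨a, ha⟩ : ∃ a, A.card = a + 1 := Nat.exists_eq_succ_of_ne_zero hA.card_pos.ne'
  obtain ⟨f, hf0, hf, hle⟩ := exists_maxOverlap_le_phaseForm (by omega : 0 < d) m a A ha
  obtain ⟨i, hi⟩ := hAc
  have : Nonempty {i // i ∉ A} := ⟨⟨i, Finset.mem_compl.1 hi⟩⟩
  obtain ⟨g, hg, hlt⟩ := exists_phaseForm_lt_succ hd hm a hf0 hf
  have hcard : Fintype.card {i // i ∉ A} = Fintype.card {i // i ∉ A'} := by
    simp only [Fintype.card_subtype_compl, Fintype.card_fin, Fintype.card_coe, hA']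
    omega
  let e := Fintype.equivOfCardEq hcard
  refine (hle.trans_lt hlt).trans_le ?_
  rw [← phaseForm_reindex d m (a + 1) e g]
  refine phaseForm_le_maxOverlap (by omega) m (a + 1) A' (by omega) _ ?_
  rw [← hg, ← (e.arrowCongr (Equiv.refl (Fin d))).sum_comp]
  simp [Function.comp_def]

theorem mainTheorem5 (d : ℕ) (hd : 2 ≤ d) (m : ℕ) (hm : ¬ d ∣ m) (n : ℕ) (hn : 2 ≤ n) :
    multipartiteEntanglement (elementaryState d (n + 1) m) <
      multipartiteEntanglement (elementaryState d n m) := by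
  have : Nonempty {A : Finset (Fin n) // A.Nonempty ∧ Aᶜ.Nonempty} :=
    ⟨{(⟨0, by omega⟩ : Fin n)}, by simp, ⟨(⟨1, by omega⟩ : Fin n), by simp⟩⟩
  obtain ⟨⟨A, hA, hAc⟩, h⟩ := exists_eq_ciInf_of_finite
    (f := fun A : {A : Finset (Fin n) // A.Nonempty ∧ Aᶜ.Nonempty} =>
      bipartiteEntanglement A.1 (elementaryState d n m))
  have hcard : A.card + Aᶜ.card = n := by simp [Finset.card_add_card_compl A]
  have hAcpos := hAc.card_pos
  -- Only the size matters: any `A'` with one more element has a complement as large as that of `A`.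
  obtain ⟨A', -, hA'⟩ := Finset.exists_subset_card_eq
    (s := (Finset.univ : Finset (Fin (n + 1)))) (n := A.card + 1) (by simp; omega)
  have hcard' : A'.card + A'ᶜ.card = n + 1 := by simp [Finset.card_add_card_compl A']
  have hA'0 : A'.Nonempty := Finset.card_pos.1 (by omega)
  have hA'c : A'ᶜ.Nonempty := Finset.card_pos.1 (by omega)
  have hlt := maxOverlap_elementaryState_lt hd hm hA hAc hA'
  unfold multipartiteEntanglement
  rw [← h]
  refine (ciInf_le (Set.finite_range _).bddBelow ⟨A', hA'0, hA'c⟩).trans_lt ?_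
  unfold bipartiteEntanglement
  linarith
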